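/- Let $\varphi$ be the morphism on finite words over $\{0,1\}$ given by $\varphi(0)=01$, $\varphi(1)=10$, and let $\mathbf{t}=01101001\cdots$ be the Thue–Morse word, i.e. the fixed point of $\varphi$ starting with $0$. For finite words $u,x$ over $\{0,1\}$, let $\binom{u}{x}$ be the number of occurrences of $x$ as a (not necessarily contiguous) subsequence of $u$. For $k\ge 1$, write $u\sim_k v$ if $\binom{u}{x}=\binom{v}{x}$ for all words $x$ over $\{0,1\}$ of length at most $k$. Let $\mathrm{Fac}_n(\mathbf{t})$ be the set of factors (blocks of consecutive letters) of length $n$ occurring in $\mathbf{t}$, let $p_{\mathbf{t}}(n)=\#\mathrm{Fac}_n(\mathbf{t})$ be the factor complexity, and let $b_{\mathbf{t},k}(n)=\#\left(\mathrm{Fac}_n(\mathbf{t})/\!\sim_k\right)$ be the $k$-binomial complexity of $\mathbf{t}$. Let $k$ be a positive integer. For all integers $0\le n\le 2^k-1$, we have $$b_{\mathbf{t},k}(n)=p_{\mathbf{t}}(n).$$ For all integers $n\ge 2^k$, we have $$b_{\mathbf{t},k}(n)=\begin{cases}3\cdot 2^k-3, & \text{if } n\equiv 0 \pmod{2^k};\\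 3\cdot 2^k-4, & \text{otherwise.}\end{cases}$$ -/

import Mathlib

namespace ThueMorse

/-- The two-letter alphabet `{0, 1}`. -/
abbrev Letter : Type := Fin 2

/-- Finite words over `{0, 1}`. -/
abbrev Word : Type := List Letter

/-- Infinite words over `{0, 1}`, indexed from `0`. -/
abbrev InfWord : Type := ℕ → Letter

/-- The factor of length `n` of `x` that starts at position `i`. -/
def factorAt (x : InfWord) (i n : ℕ) : Word :=
  (List.range n).map fun j => x (i + j)

/-- The set of factors (blocks of consecutive letters) of length `n` occurring in `x`. -/
def Fac (x : InfWord) (n : ℕ) : Set Word :=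
  {w | ∃ i : ℕ, w = factorAt x i n}

/-- The factor complexity of `x`: the number of its factors of length `n`. -/
noncomputable def factorComplexity (x : InfWord) (n : ℕ) : ℕ :=
  Nat.card (Fac x n)

/-- The binomial coefficient of two words: the number of occurrences of `v` as a subsequence
of `u`. The list `u.sublists'` has one entry for each set of positions of `u`, so `v` is counted
with multiplicity. -/
def binom (u v : Word) : ℕ :=
  u.sublists'.count v

/-- `k`-binomial equivalence, as a relation on words. -/
def binomSetoid (k : ℕ) : Setoid Word where
  r u v := ∀ x : Word, x.length ≤ k → binom u x = binom v x
  iseqv :=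
    { refl := fun _ _ _ => rfl
      symm := fun h x hx => (h x hx).symm
      trans := fun h h' x hx => (h x hx).trans (h' x hx) }

/-- The `k`-binomial complexity of `x`: the number of classes, for the restriction of
`k`-binomial equivalence, of factors of length `n`. -/
noncomputable def binomComplexity (x : InfWord) (k n : ℕ) : ℕ :=
  Nat.card (Quotient ((binomSetoid k).comap (Subtype.val : Fac x n → Word)))

/-- Images of letters under the Thue–Morse morphism: `0 ↦ 01` and `1 ↦ 10`. -/
def phiLetter (a : Letter) : Word :=
  if a = 0 then [0, 1] else [1, 0]

/-- The Thue–Morse morphism on finite words. -/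
def phi (w : Word) : Word :=
  w.flatMap phiLetter

theorem length_phi (w : Word) : (phi w).length = 2 * w.length := by
  induction w with
  | nil => rfl
  | cons a w ih =>
    have h : (phiLetter a).length = 2 := by fin_cases a <;> rfl
    simp only [phi, List.flatMap_cons, List.length_append, List.length_cons] at ih ⊢
    omega

theorem length_phi_iterate (n : ℕ) : (phi^[n] [0]).length = 2 ^ n := by
  induction n with
  | zero => rfl
  | succ n ih => rw [Function.iterate_succ_apply', length_phi, ih, pow_succ']

/-- The Thue–Morse word, the limit of the words `φⁿ(0)`: its letter at position `n` is the one
of `φⁿ(0)`, a word of length `2 ^ n > n`. -/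
def thueMorse : InfWord := fun n =>
  (phi^[n] [0])[n]'(by rw [length_phi_iterate]; exact Nat.lt_two_pow_self)

theorem phi_append (u v : Word) : phi (u ++ v) = phi u ++ phi v := by
  simp [phi]

theorem phi_iterate_prefix_succ (n : ℕ) : phi^[n] [0] <+: phi^[n + 1] [0] := by
  induction n with
  | zero => exact ⟨[1], rfl⟩
  | succ n ih =>
    obtain ⟨s, hs⟩ := ih
    rw [Function.iterate_succ_apply' phi n, Function.iterate_succ_apply' phi (n + 1), ← hs,
      phi_append]
    exact ⟨phi s, rfl⟩

theorem phi_iterate_prefix {m n : ℕ} (h : m ≤ n) : phi^[m] [0] <+: phi^[n] [0] := by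
  induction n, h using Nat.le_induction with
  | base => exact List.prefix_rfl
  | succ n _ ih => exact ih.trans (phi_iterate_prefix_succ n)

/-- Each `φᵐ(0)` is a prefix of the Thue–Morse word. -/
theorem factorAt_thueMorse (m : ℕ) : factorAt thueMorse 0 (2 ^ m) = phi^[m] [0] := by
  apply List.ext_getElem
  · simp [factorAt, length_phi_iterate]
  · intro i h₁ h₂
    simp only [factorAt, List.getElem_map, List.getElem_range, zero_add, thueMorse]
    rcases le_total i m with h | h
    · exact (phi_iterate_prefix h).getElem _
    · exact ((phi_iterate_prefix h).getElem _).symm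

theorem thueMorse_zero : thueMorse 0 = 0 := rfl

/-- The Thue–Morse word is a fixed point of `φ`: the image of its prefix of length `n` is its
prefix of length `2 * n`. -/
theorem phi_factorAt_thueMorse (n : ℕ) :
    phi (factorAt thueMorse 0 n) = factorAt thueMorse 0 (2 * n) := by
  have hpre : ∀ {a b : ℕ}, a ≤ b → factorAt thueMorse 0 a <+: factorAt thueMorse 0 b := by
    intro a b hab
    obtain ⟨c, rfl⟩ := Nat.exists_eq_add_of_le hab
    simp [factorAt, List.range_add]
  have hn : n ≤ 2 ^ n := Nat.lt_two_pow_self.le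
  have h₁ : phi (factorAt thueMorse 0 n) <+: factorAt thueMorse 0 (2 ^ (n + 1)) := by
    obtain ⟨s, hs⟩ := hpre hn
    rw [factorAt_thueMorse, Function.iterate_succ_apply', ← factorAt_thueMorse, ← hs, phi_append]
    exact ⟨phi s, rfl⟩
  have h₂ : factorAt thueMorse 0 (2 * n) <+: factorAt thueMorse 0 (2 ^ (n + 1)) :=
    hpre (by rw [pow_succ']; omega)
  refine (List.prefix_of_prefix_length_le h₁ h₂ ?_).eq_of_length ?_ <;>
    simp [length_phi, factorAt]

end ThueMorse

/-!
To a word `u` attach the polynomial `P u = ∑ i, ± (1 + X) ^ i`, the sign being that of the letter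
`uᵢ`. Modulo `X ^ k` it is an invariant of the `k`-binomial class, and since
`P (φ u) = -X * (P u)(X ^ 2 + 2 * X)`, applying `φ` raises the order of an `X`-adic congruence by
exactly one. A factor of `𝐭` has the form `p φ(u) s` with `p` and `s` of length at most one, and
from length `4` on the first two coefficients of `P` detect the parity of its position and the
letters of `p` and `s`. As `φ` also turns `k`-binomial equivalence into `(k + 1)`-binomial
equivalence, an induction on `k` shows that on factors of `𝐭` the congruence modulo `X ^ k` is
`k`-binomial equivalence, and that it is equality below length `2 ^ k`. The same desubstitution
gives a recursion for the number of classes, once one also counts the classes refined by the first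
or the last letter.
-/

namespace ThueMorse

open Polynomial

local notation "𝐭" => thueMorse

variable {k : ℕ} {u v : Word}

/-! ### Binomial coefficients of words -/

theorem binom_nil_right (u : Word) : binom u [] = 1 := by
  induction u with
  | nil => rfl
  | cons a u ih =>
    unfold binom at ih ⊢
    rw [List.sublists'_cons, List.count_append, ih, Nat.add_eq_left, List.count_eq_zero]
    simp

theorem binom_nil_cons (b : Letter) (x : Word) : binom [] (b :: x) = 0 := by
  simp [binom]

theorem binom_cons_cons (a : Letter) (u : Word) (b : Letter) (x : Word) :
    binom (a :: u) (b :: x) = binom u (b :: x) + if a = b then binom u x else 0 := by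
  unfold binom
  rw [List.sublists'_cons, List.count_append]
  congr 1
  split_ifs with h
  · subst h
    exact List.count_map_of_injective _ _ List.cons_injective _
  · rw [List.count_eq_zero]
    simp [h]

theorem binom_reverse (u x : Word) : binom u.reverse x.reverse = binom u x := by
  unfold binom
  rw [List.sublists'_reverse, List.count_map_of_injective _ _ List.reverse_injective,
    (List.sublists_perm_sublists' u).count_eq]

theorem binomSetoid_reverse (h : binomSetoid k u v) : binomSetoid k u.reverse v.reverse := by
  intro x hx
  rw [← x.reverse_reverse, binom_reverse, binom_reverse]
  exact h _ (by simpa using hx)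

theorem binomSetoid_cons (a : Letter) (h : binomSetoid k u v) :
    binomSetoid k (a :: u) (a :: v) := by
  intro x hx
  cases x with
  | nil => rw [binom_nil_right, binom_nil_right]
  | cons b x =>
    rw [binom_cons_cons, binom_cons_cons, h _ hx, h x (Nat.le_of_succ_le hx)]

theorem binomSetoid_append_left (p : Word) (h : binomSetoid k u v) :
    binomSetoid k (p ++ u) (p ++ v) := by
  induction p with
  | nil => exact h
  | cons a p ih => exact binomSetoid_cons a ih

theorem binomSetoid_append_right (s : Word) (h : binomSetoid k u v) :
    binomSetoid k (u ++ s) (v ++ s) := by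
  simpa using binomSetoid_reverse (binomSetoid_append_left s.reverse (binomSetoid_reverse h))

/-! ### Functions spanned by binomial coefficients -/

/-- The `ℤ`-linear combinations of the functions `u ↦ binom u y` with `y` of length at most `k`.
Membership certifies that a function on words is constant on `k`-binomial classes. -/
def binomSpan (k : ℕ) : Submodule ℤ (Word → ℤ) :=
  Submodule.span ℤ ((fun y u => (binom u y : ℤ)) '' {y | y.length ≤ k})

theorem binom_mem_binomSpan {y : Word} (hy : y.length ≤ k) :
    (fun u => (binom u y : ℤ)) ∈ binomSpan k :=
  Submodule.subset_span ⟨y, hy, rfl⟩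

theorem const_mem_binomSpan (k : ℕ) (c : ℤ) : (fun _ => c) ∈ binomSpan k := by
  convert (binomSpan k).smul_mem c (binom_mem_binomSpan (y := []) k.zero_le) using 1
  simp [binom_nil_right, funext_iff]

theorem binomSpan_mono : Monotone binomSpan :=
  fun _ _ h => Submodule.span_mono (Set.image_mono fun _ hy => le_trans hy h)

theorem eq_of_mem_binomSpan (h : binomSetoid k u v) {f : Word → ℤ} (hf : f ∈ binomSpan k) :
    f u = f v := by
  refine LinearMap.eqOn_span (f := LinearMap.proj (R := ℤ) u) (g := LinearMap.proj v) ?_ hf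
  rintro _ ⟨y, hy, rfl⟩
  exact congrArg Nat.cast (h y hy)

theorem exists_primitive_of_mem_binomSpan (a : Letter) {r : Word → ℤ} (hr : r ∈ binomSpan k) :
    ∃ h ∈ binomSpan (k + 1), h [] = 0 ∧
      ∀ b u, h (b :: u) = h u + if b = a then r u else 0 := by
  induction hr using Submodule.span_induction with
  | mem r hr =>
    obtain ⟨y, hy, rfl⟩ := hr
    refine ⟨_, binom_mem_binomSpan (y := a :: y) (Nat.succ_le_succ hy), ?_, ?_⟩
    · rw [binom_nil_cons, Nat.cast_zero]
    · intro b u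
      rw [binom_cons_cons]
      push_cast
      rfl
  | zero => exact ⟨0, zero_mem _, rfl, by simp⟩
  | add r r' _ _ ih ih' =>
    obtain ⟨h, hmem, h_nil, h_cons⟩ := ih
    obtain ⟨h', hmem', h_nil', h_cons'⟩ := ih'
    refine ⟨h + h', add_mem hmem hmem', by simp [h_nil, h_nil'], fun b u => ?_⟩
    simp only [Pi.add_apply, h_cons, h_cons']
    split_ifs <;> ring
  | smul c r _ ih =>
    obtain ⟨h, hmem, h_nil, h_cons⟩ := ih
    refine ⟨c • h, Submodule.smul_mem _ c hmem, by simp [h_nil], fun b u => ?_⟩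
    simp only [Pi.smul_apply, smul_eq_mul, h_cons, mul_add, mul_ite, mul_zero]

theorem mem_binomSpan_succ {h : Word → ℤ} {r : Letter → Word → ℤ}
    (hr : ∀ a, r a ∈ binomSpan k) (h_cons : ∀ a u, h (a :: u) = h u + r a u) :
    h ∈ binomSpan (k + 1) := by
  choose g hg g_nil g_cons using fun a => exists_primitive_of_mem_binomSpan a (hr a)
  have h_eq : h = (fun _ => h []) + ∑ a, g a := by
    funext u
    induction u with
    | nil => simp [g_nil]
    | cons b u ih =>
      rw [h_cons, ih]
      simp only [Pi.add_apply, Finset.sum_apply, g_cons, Finset.sum_add_distrib,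
        Finset.sum_ite_eq, Finset.mem_univ, if_true, add_assoc]
  rw [h_eq]
  exact add_mem (const_mem_binomSpan _ _) (sum_mem fun a _ => hg a)

/-! ### Binomial coefficients of images under the morphism -/

theorem phi_cons (a : Letter) (u : Word) : phi (a :: u) = a :: (1 - a) :: phi u := by
  fin_cases a <;> rfl

theorem binom_phi_singleton (u : Word) (b : Letter) : binom (phi u) [b] = u.length := by
  induction u with
  | nil => exact binom_nil_cons b []
  | cons a u ih =>
    rw [phi_cons, binom_cons_cons, binom_cons_cons, ih, binom_nil_right, binom_nil_right,
      List.length_cons, add_assoc, Nat.add_left_cancel_iff]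
    clear ih
    revert a b
    decide

theorem binom_phi_cons_cons_cons (a : Letter) (u : Word) (b c : Letter) (y : Word) :
    binom (phi (a :: u)) (b :: c :: y) = binom (phi u) (b :: c :: y) +
      (binom (phi u) (c :: y) + if a = b ∧ c = 1 - b then binom (phi u) y else 0) := by
  simp only [phi_cons, binom_cons_cons]
  fin_cases a <;> fin_cases b <;> fin_cases c <;> simp

theorem ite_mem_binomSpan {f : Word → ℤ} (p : Prop) [Decidable p] (hf : f ∈ binomSpan k) :
    (fun u => if p then f u else 0) ∈ binomSpan k := by
  split_ifs
  exacts [hf, zero_mem _]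

theorem binom_phi_mem_binomSpan (x : Word) :
    (fun u => (binom (phi u) x : ℤ)) ∈ binomSpan x.length := by
  induction x using List.twoStepInduction with
  | nil =>
    simp only [binom_nil_right]
    exact const_mem_binomSpan _ _
  | singleton b =>
    simp only [binom_phi_singleton]
    exact mem_binomSpan_succ (r := fun _ _ => 1) (fun _ => const_mem_binomSpan 0 1) (by simp)
  | cons_cons b c y ih_y ih_cy =>
    refine mem_binomSpan_succ
      (fun a => add_mem (ih_cy c)
        (ite_mem_binomSpan (a = b ∧ c = 1 - b) (binomSpan_mono y.length.le_succ ih_y)))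
      fun a u => ?_
    rw [binom_phi_cons_cons_cons]
    push_cast
    rfl

/- The top-degree part of `binom (φ u) x` only counts positions, because `φ 0` and `φ 1` have the
same letter counts; this is where the gain of one order under `φ` comes from. -/
theorem exists_binom_phi_sub_mem_binomSpan (x : Word) :
    ∃ g : ℕ → ℤ,
      (fun u => (binom (phi u) x : ℤ) - g u.length) ∈ binomSpan (x.length - 1) := by
  induction x using List.twoStepInduction with
  | nil => exact ⟨0, by simpa using binom_phi_mem_binomSpan []⟩
  | singleton b => exact ⟨Nat.cast, by simpa [binom_phi_singleton] using const_mem_binomSpan 0 0⟩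
  | cons_cons b c y _ ih =>
    obtain ⟨g, hg⟩ := ih c
    refine ⟨fun n => ∑ i ∈ Finset.range n, g i,
      mem_binomSpan_succ (fun a => add_mem hg
        (ite_mem_binomSpan (a = b ∧ c = 1 - b) (binom_phi_mem_binomSpan y))) fun a u => ?_⟩
    simp only [binom_phi_cons_cons_cons, List.length_cons, Finset.sum_range_succ, Pi.add_apply]
    push_cast
    ring

theorem binomSetoid_phi (h : binomSetoid k u v) (hl : u.length = v.length) :
    binomSetoid (k + 1) (phi u) (phi v) := by
  intro x hx
  obtain ⟨g, hg⟩ := exists_binom_phi_sub_mem_binomSpan x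
  have h_sub := eq_of_mem_binomSpan h (binomSpan_mono (by omega) hg)
  rw [hl] at h_sub
  exact_mod_cast sub_left_injective h_sub

/-! ### The sign polynomial of a word -/

/-- The sign `1` of the letter `0` and `-1` of the letter `1`. -/
def sign (a : Letter) : ℤ := if a = 0 then 1 else -1

theorem sign_eq_or (a : Letter) : sign a = 1 ∨ sign a = -1 := by
  revert a
  decide

theorem sign_one_sub (a : Letter) : sign (1 - a) = -sign a := by
  revert a
  decide

theorem sign_injective : Function.Injective sign := by
  decide

/-- The sum of the signs of the letters of a word. -/
def signSum (u : Word) : ℤ := (u.map sign).sum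

theorem signSum_cons (a : Letter) (u : Word) : signSum (a :: u) = sign a + signSum u := by
  simp [signSum]

theorem signSum_concat (u : Word) (a : Letter) : signSum (u ++ [a]) = signSum u + sign a := by
  simp [signSum]

theorem signSum_phi (u : Word) : signSum (phi u) = 0 := by
  induction u with
  | nil => rfl
  | cons a u ih => rw [phi_cons, signSum_cons, signSum_cons, ih, sign_one_sub]; ring

theorem abs_signSum_le_length (u : Word) : |signSum u| ≤ u.length := by
  induction u with
  | nil => rfl
  | cons a u ih =>
    rw [signSum_cons, List.length_cons]
    rw [abs_le] at ih ⊢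
    rcases sign_eq_or a with h | h <;> omega

theorem signSum_eq_binom_sub (u : Word) : signSum u = (binom u [0] : ℤ) - binom u [1] := by
  induction u with
  | nil => rfl
  | cons a u ih =>
    rw [signSum_cons, ih, binom_cons_cons, binom_cons_cons, binom_nil_right]
    fin_cases a <;> simp [sign] <;> ring

theorem length_eq_binom_add (u : Word) : u.length = binom u [0] + binom u [1] := by
  induction u with
  | nil => rfl
  | cons a u ih =>
    rw [List.length_cons, ih, binom_cons_cons, binom_cons_cons, binom_nil_right]
    fin_cases a <;> simp <;> ring

theorem binomSetoid_one_of_signSum_eq (hl : u.length = v.length) (hs : signSum u = signSum v) :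
    binomSetoid 1 u v := by
  intro x hx
  rw [length_eq_binom_add, length_eq_binom_add] at hl
  rw [signSum_eq_binom_sub, signSum_eq_binom_sub] at hs
  match x, hx with
  | [], _ => rw [binom_nil_right, binom_nil_right]
  | [0], _ => omega
  | [1], _ => omega

/-- The polynomial `∑ i, sign uᵢ * (1 + X) ^ i` of a word `u`, whose coefficient of `X ^ j` counts
with signs the subsequences of length `j + 1` of `u`, according to their last letter. -/
noncomputable def signPoly : Word → ℤ[X]
  | [] => 0
  | a :: u => C (sign a) + (1 + X) * signPoly u

theorem signPoly_concat (u : Word) (a : Letter) :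
    signPoly (u ++ [a]) = signPoly u + (1 + X) ^ u.length * C (sign a) := by
  induction u with
  | nil => simp [signPoly]
  | cons b u ih =>
    simp only [List.cons_append, signPoly, ih, List.length_cons]
    ring

theorem signPoly_phi (u : Word) :
    signPoly (phi u) = -(X * (signPoly u).comp (X * (X + 2))) := by
  induction u with
  | nil => simp [phi, signPoly]
  | cons a u ih =>
    simp only [phi_cons, signPoly, ih, sign_one_sub, add_comp, mul_comp, C_comp, one_comp, X_comp,
      C_neg]
    ring

theorem coeff_zero_signPoly (u : Word) : (signPoly u).coeff 0 = signSum u := by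
  induction u with
  | nil => simp [signPoly, signSum]
  | cons a u ih => simp [signPoly, signSum_cons, add_mul, ih]

theorem coeff_succ_signPoly_cons (a : Letter) (u : Word) (j : ℕ) :
    (signPoly (a :: u)).coeff (j + 1) = (signPoly u).coeff (j + 1) + (signPoly u).coeff j := by
  rw [signPoly, coeff_add, coeff_C_succ, add_mul, one_mul, coeff_add, coeff_X_mul, zero_add]

theorem coeff_one_signPoly_cons (a : Letter) (u : Word) :
    (signPoly (a :: u)).coeff 1 = (signPoly u).coeff 1 + signSum u := by
  rw [← coeff_zero_signPoly, coeff_succ_signPoly_cons]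

theorem coeff_one_signPoly_concat (u : Word) (a : Letter) :
    (signPoly (u ++ [a])).coeff 1 = (signPoly u).coeff 1 + u.length * sign a := by
  simp [signPoly_concat, coeff_one_add_X_pow]

theorem coeff_one_signPoly_phi (u : Word) : (signPoly (phi u)).coeff 1 = -signSum u := by
  rw [signPoly_phi, coeff_neg, coeff_X_mul, ← coeff_zero_signPoly, coeff_zero_eq_eval_zero,
    coeff_zero_eq_eval_zero, eval_comp]
  simp

theorem coeff_signPoly_mem_binomSpan (j : ℕ) :
    (fun u => (signPoly u).coeff j) ∈ binomSpan (j + 1) := by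
  induction j with
  | zero =>
    simp only [coeff_zero_signPoly]
    exact mem_binomSpan_succ (fun a => const_mem_binomSpan 0 (sign a))
      fun a u => by rw [signSum_cons, add_comm]
  | succ j ih => exact mem_binomSpan_succ (fun _ => ih) fun a u => coeff_succ_signPoly_cons a u j

/-! ### Divisibility by powers of `X` -/

section Divisibility

variable {R : Type*} [CommRing R] [IsDomain R] {p q : R[X]}

theorem X_pow_dvd_mul_iff (hp : p.coeff 0 ≠ 0) : X ^ k ∣ p * q ↔ X ^ k ∣ q :=
  ⟨prime_X.pow_dvd_of_dvd_mul_left k (mt X_dvd_iff.1 hp), fun h => h.mul_left p⟩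

theorem X_pow_dvd_comp_X_mul_iff (hq : q.coeff 0 ≠ 0) :
    X ^ k ∣ p.comp (X * q) ↔ X ^ k ∣ p := by
  induction k generalizing p with
  | zero => simp
  | succ k ih =>
    have h_one : X ∣ p.comp (X * q) ↔ X ∣ p := by
      simp [X_dvd_iff, coeff_zero_eq_eval_zero, eval_comp]
    by_cases hp : X ∣ p
    · obtain ⟨r, rfl⟩ := hp
      rw [mul_comp, X_comp, mul_assoc, pow_succ', mul_dvd_mul_iff_left X_ne_zero,
        mul_dvd_mul_iff_left X_ne_zero, X_pow_dvd_mul_iff hq, ih]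
    · have not_dvd {r : R[X]} (hr : ¬ X ∣ r) : ¬ X ^ (k + 1) ∣ r :=
        mt (dvd_pow_self X k.succ_ne_zero).trans hr
      exact iff_of_false (not_dvd (mt h_one.1 hp)) (not_dvd hp)

end Divisibility

/-! ### Sign equivalence of words -/

/-- Two words are sign equivalent of order `k` if their sign polynomials agree modulo `X ^ k`. On
factors of the Thue–Morse word this is `k`-binomial equivalence. -/
def SignEquiv (k : ℕ) (u v : Word) : Prop := X ^ k ∣ signPoly u - signPoly v

theorem SignEquiv.refl (k : ℕ) (u : Word) : SignEquiv k u u := by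
  simp [SignEquiv]

theorem SignEquiv.symm (h : SignEquiv k u v) : SignEquiv k v u :=
  (dvd_sub_comm ..).1 h

theorem SignEquiv.trans {w : Word} (h : SignEquiv k u v) (h' : SignEquiv k v w) :
    SignEquiv k u w := by
  simpa [SignEquiv] using dvd_add h h'

theorem SignEquiv.mono {l : ℕ} (hkl : k ≤ l) (h : SignEquiv l u v) : SignEquiv k u v :=
  (pow_dvd_pow X hkl).trans h

theorem signEquiv_iff_forall_coeff :
    SignEquiv k u v ↔ ∀ j < k, (signPoly u).coeff j = (signPoly v).coeff j := by
  simp only [SignEquiv, X_pow_dvd_iff, coeff_sub, sub_eq_zero]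

theorem signEquiv_of_binomSetoid (h : binomSetoid k u v) : SignEquiv k u v :=
  signEquiv_iff_forall_coeff.2 fun j hj =>
    eq_of_mem_binomSpan h (binomSpan_mono hj (coeff_signPoly_mem_binomSpan j))

theorem signEquiv_one_iff : SignEquiv 1 u v ↔ signSum u = signSum v := by
  simp [signEquiv_iff_forall_coeff, coeff_zero_signPoly]

theorem signEquiv_two_iff :
    SignEquiv 2 u v ↔
      signSum u = signSum v ∧ (signPoly u).coeff 1 = (signPoly v).coeff 1 := by
  simp [signEquiv_iff_forall_coeff, Nat.le_one_iff_eq_zero_or_eq_one, coeff_zero_signPoly]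

theorem signEquiv_cons_iff (a : Letter) : SignEquiv k (a :: u) (a :: v) ↔ SignEquiv k u v := by
  rw [SignEquiv, signPoly, signPoly, add_sub_add_left_eq_sub, ← mul_sub,
    X_pow_dvd_mul_iff (by simp), SignEquiv]

theorem signEquiv_concat_iff (a : Letter) (hl : u.length = v.length) :
    SignEquiv k (u ++ [a]) (v ++ [a]) ↔ SignEquiv k u v := by
  rw [SignEquiv, signPoly_concat, signPoly_concat, hl, add_sub_add_right_eq_sub, SignEquiv]

theorem signEquiv_phi_iff : SignEquiv (k + 1) (phi u) (phi v) ↔ SignEquiv k u v := by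
  rw [SignEquiv, signPoly_phi, signPoly_phi, neg_sub_neg, ← mul_sub, ← sub_comp, pow_succ',
    mul_dvd_mul_iff_left X_ne_zero, X_pow_dvd_comp_X_mul_iff (by simp), dvd_sub_comm, SignEquiv]

theorem signEquiv_cons_phi_iff {a a' : Letter} :
    SignEquiv (k + 1) (a :: phi u) (a' :: phi v) ↔ a = a' ∧ SignEquiv k u v := by
  constructor
  · intro h
    have h_sum := signEquiv_one_iff.1 (h.mono (by omega))
    simp only [signSum_cons, signSum_phi, add_zero] at h_sum
    obtain rfl := sign_injective h_sum
    exact ⟨rfl, signEquiv_phi_iff.1 ((signEquiv_cons_iff a).1 h)⟩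
  · rintro ⟨rfl, h⟩
    exact (signEquiv_cons_iff a).2 (signEquiv_phi_iff.2 h)

theorem signEquiv_phi_concat_iff {b b' : Letter} (hl : u.length = v.length) :
    SignEquiv (k + 1) (phi u ++ [b]) (phi v ++ [b']) ↔ b = b' ∧ SignEquiv k u v := by
  have hl' : (phi u).length = (phi v).length := by rw [length_phi, length_phi, hl]
  constructor
  · intro h
    have h_sum := signEquiv_one_iff.1 (h.mono (by omega))
    simp only [signSum_concat, signSum_phi, zero_add] at h_sum
    obtain rfl := sign_injective h_sum
    exact ⟨rfl, signEquiv_phi_iff.1 ((signEquiv_concat_iff b hl').1 h)⟩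
  · rintro ⟨rfl, h⟩
    exact (signEquiv_concat_iff b hl').2 (signEquiv_phi_iff.2 h)

theorem signSum_cons_phi_concat (a : Letter) (u : Word) (b : Letter) :
    signSum (a :: (phi u ++ [b])) = sign a + sign b := by
  rw [signSum_cons, signSum_concat, signSum_phi, zero_add]

theorem coeff_one_signPoly_cons_phi_concat (a : Letter) (u : Word) (b : Letter) :
    (signPoly (a :: (phi u ++ [b]))).coeff 1 = (2 * u.length + 1) * sign b - signSum u := by
  rw [coeff_one_signPoly_cons, coeff_one_signPoly_concat, coeff_one_signPoly_phi, signSum_concat,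
    signSum_phi, length_phi]
  push_cast
  ring

theorem eq_of_signEquiv_two_cons_phi_concat {a a' b b' : Letter} (hl : u.length = v.length)
    (h : SignEquiv 2 (a :: (phi u ++ [b])) (a' :: (phi v ++ [b']))) : b = b' := by
  obtain ⟨-, h_one⟩ := signEquiv_two_iff.1 h
  have hu := abs_le.1 (abs_signSum_le_length u)
  have hv := abs_le.1 (abs_signSum_le_length v)
  rw [coeff_one_signPoly_cons_phi_concat, coeff_one_signPoly_cons_phi_concat] at h_one
  apply sign_injective
  rcases sign_eq_or b with hb | hb <;> rcases sign_eq_or b' with hb' | hb' <;>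
    rw [hb, hb'] at h_one ⊢ <;> omega

theorem signEquiv_cons_phi_concat_iff (hk : 0 < k) {a a' b b' : Letter}
    (hl : u.length = v.length) :
    SignEquiv (k + 1) (a :: (phi u ++ [b])) (a' :: (phi v ++ [b'])) ↔
      a = a' ∧ b = b' ∧ SignEquiv k u v := by
  constructor
  · intro h
    have h_two : SignEquiv 2 _ _ := h.mono (by omega)
    obtain rfl := eq_of_signEquiv_two_cons_phi_concat hl h_two
    have h_sum := (signEquiv_two_iff.1 h_two).1
    rw [signSum_cons_phi_concat, signSum_cons_phi_concat, add_left_inj] at h_sum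
    obtain rfl := sign_injective h_sum
    exact ⟨rfl, (signEquiv_phi_concat_iff hl).1 ((signEquiv_cons_iff a).1 h)⟩
  · rintro ⟨rfl, h⟩
    exact (signEquiv_cons_iff a).2 ((signEquiv_phi_concat_iff hl).2 h)

theorem not_signEquiv_two_phi_cons_phi_concat {a b : Letter} (hl : u.length = v.length + 1)
    (hu₂ : 2 ≤ u.length) (hu : |signSum u| ≤ 2) (hv : |signSum (a :: (v ++ [b]))| ≤ 2) :
    ¬ SignEquiv 2 (phi u) ((1 - a) :: (phi v ++ [b])) := by
  intro h
  obtain ⟨h_zero, h_one⟩ := signEquiv_two_iff.1 h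
  rw [signSum_phi, signSum_cons_phi_concat, sign_one_sub] at h_zero
  rw [coeff_one_signPoly_phi, coeff_one_signPoly_cons_phi_concat] at h_one
  rw [signSum_cons, signSum_concat] at hv
  rw [abs_le] at hu hv
  rcases sign_eq_or b with hb | hb <;> rw [hb] at h_zero h_one hv <;> omega

theorem not_signEquiv_two_phi_concat_cons_phi {a b : Letter} (hl : u.length = v.length)
    (hu₂ : 2 ≤ u.length) (hu : |signSum (u ++ [b])| ≤ 2) (hv : |signSum (a :: v)| ≤ 2) :
    ¬ SignEquiv 2 (phi u ++ [b]) ((1 - a) :: phi v) := by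
  intro h
  obtain ⟨h_zero, h_one⟩ := signEquiv_two_iff.1 h
  rw [signSum_concat, signSum_cons, signSum_phi, signSum_phi, sign_one_sub] at h_zero
  rw [coeff_one_signPoly_concat, coeff_one_signPoly_cons, coeff_one_signPoly_phi,
    coeff_one_signPoly_phi, signSum_phi, length_phi] at h_one
  rw [signSum_concat] at hu
  rw [signSum_cons] at hv
  push_cast at h_one
  rw [abs_le] at hu hv
  rcases sign_eq_or b with hb | hb <;> rw [hb] at h_zero h_one hu <;> omega

theorem eq_of_signEquiv_one_of_length_le_one (hl : u.length = v.length) (hu : u.length ≤ 1)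
    (h : SignEquiv 1 u v) : u = v := by
  rw [signEquiv_one_iff] at h
  match u, v, hl, hu with
  | [], [], _, _ => rfl
  | [a], [a'], _, _ =>
    rw [signSum_cons, signSum_cons, add_left_inj] at h
    rw [sign_injective h]

theorem eq_of_signEquiv_two_of_length_le_three (hl : u.length = v.length) (hu : u.length ≤ 3)
    (h : SignEquiv 2 u v) : u = v := by
  obtain ⟨h_zero, h_one⟩ := signEquiv_two_iff.1 h
  have signs_eq {a b : Letter} (hab : sign a = sign b) : a = b := sign_injective hab
  match u, v, hl, hu with
  | [], [], _, _ => rfl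
  | [a], [a'], _, _ =>
    simp only [signSum_cons, coeff_one_signPoly_cons] at h_zero h_one
    rw [signs_eq (by omega : sign a = sign a')]
  | [a, b], [a', b'], _, _ =>
    simp only [signSum_cons, coeff_one_signPoly_cons] at h_zero h_one
    rw [signs_eq (by omega : sign a = sign a'), signs_eq (by omega : sign b = sign b')]
  | [a, b, c], [a', b', c'], _, _ =>
    simp only [signSum_cons, coeff_one_signPoly_cons] at h_zero h_one
    have := sign_eq_or a
    have := sign_eq_or a'
    have := sign_eq_or b
    have := sign_eq_or b'
    have := sign_eq_or c
    have := sign_eq_or c'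
    rw [signs_eq (by omega : sign a = sign a'), signs_eq (by omega : sign b = sign b'),
      signs_eq (by omega : sign c = sign c')]


/-! ### Factors of the Thue–Morse word -/

theorem length_factorAt (x : InfWord) (i n : ℕ) : (factorAt x i n).length = n := by
  simp [factorAt]

theorem length_factorAt_eq (x : InfWord) (i j n : ℕ) :
    (factorAt x i n).length = (factorAt x j n).length := by
  rw [length_factorAt, length_factorAt]

theorem factorAt_succ (x : InfWord) (i n : ℕ) :
    factorAt x i (n + 1) = x i :: factorAt x (i + 1) n := by
  simp [factorAt, List.range_succ_eq_map, Function.comp_def, Nat.add_assoc, Nat.add_comm 1]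

theorem factorAt_succ' (x : InfWord) (i n : ℕ) :
    factorAt x i (n + 1) = factorAt x i n ++ [x (i + n)] := by
  simp [factorAt, List.range_succ]

theorem head?_factorAt_succ (x : InfWord) (i n : ℕ) :
    (factorAt x i (n + 1)).head? = some (x i) := by
  rw [factorAt_succ, List.head?_cons]

theorem getLast?_factorAt_succ (x : InfWord) (i n : ℕ) :
    (factorAt x i (n + 1)).getLast? = some (x (i + n)) := by
  rw [factorAt_succ', List.getLast?_concat]

theorem thueMorse_two_mul_and_add_one (i : ℕ) : 𝐭 (2 * i) = 𝐭 i ∧ 𝐭 (2 * i + 1) = 1 - 𝐭 i := by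
  have h := phi_factorAt_thueMorse (i + 1)
  rw [factorAt_succ', phi_append, phi_factorAt_thueMorse, mul_add_one, factorAt_succ',
    factorAt_succ', List.append_assoc, List.append_cancel_left_eq, phi_cons] at h
  simpa [phi, eq_comm] using h

theorem thueMorse_two_mul (i : ℕ) : 𝐭 (2 * i) = 𝐭 i :=
  (thueMorse_two_mul_and_add_one i).1

theorem thueMorse_two_mul_add_one (i : ℕ) : 𝐭 (2 * i + 1) = 1 - 𝐭 i :=
  (thueMorse_two_mul_and_add_one i).2

theorem factorAt_two_mul_two_mul (i m : ℕ) :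
    factorAt 𝐭 (2 * i) (2 * m) = phi (factorAt 𝐭 i m) := by
  induction m generalizing i with
  | zero => rfl
  | succ m ih =>
    rw [mul_add_one, factorAt_succ, factorAt_succ, factorAt_succ, phi_cons, thueMorse_two_mul,
      thueMorse_two_mul_add_one, ← ih, mul_add_one]

theorem factorAt_two_mul_two_mul_add_one (i m : ℕ) :
    factorAt 𝐭 (2 * i) (2 * m + 1) = phi (factorAt 𝐭 i m) ++ [𝐭 (i + m)] := by
  rw [factorAt_succ', factorAt_two_mul_two_mul, ← mul_add, thueMorse_two_mul]

theorem factorAt_two_mul_add_one_two_mul_add_one (i m : ℕ) :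
    factorAt 𝐭 (2 * i + 1) (2 * m + 1) = (1 - 𝐭 i) :: phi (factorAt 𝐭 (i + 1) m) := by
  rw [factorAt_succ, thueMorse_two_mul_add_one, ← factorAt_two_mul_two_mul, mul_add_one]

theorem factorAt_two_mul_add_one_two_mul_add_two (i m : ℕ) :
    factorAt 𝐭 (2 * i + 1) (2 * (m + 1)) =
      (1 - 𝐭 i) :: (phi (factorAt 𝐭 (i + 1) m) ++ [𝐭 (i + 1 + m)]) := by
  rw [mul_add_one, factorAt_succ, thueMorse_two_mul_add_one, ← factorAt_two_mul_two_mul_add_one,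
    mul_add_one]

theorem factorAt_add_two (i m : ℕ) :
    factorAt 𝐭 i (m + 2) = 𝐭 i :: (factorAt 𝐭 (i + 1) m ++ [𝐭 (i + 1 + m)]) := by
  rw [factorAt_succ, factorAt_succ']

theorem abs_signSum_factorAt_le_two (i n : ℕ) : |signSum (factorAt 𝐭 i n)| ≤ 2 := by
  obtain ⟨i, rfl | rfl⟩ := i.even_or_odd' <;> obtain ⟨m, rfl | rfl⟩ := n.even_or_odd'
  · simp [factorAt_two_mul_two_mul, signSum_phi]
  · rw [factorAt_two_mul_two_mul_add_one, signSum_concat, signSum_phi, abs_le]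
    have := sign_eq_or (𝐭 (i + m))
    omega
  · cases m with
    | zero => simp [factorAt, signSum]
    | succ m =>
      rw [factorAt_two_mul_add_one_two_mul_add_two, signSum_cons_phi_concat, abs_le]
      have := sign_eq_or (1 - 𝐭 i)
      have := sign_eq_or (𝐭 (i + 1 + m))
      omega
  · rw [factorAt_two_mul_add_one_two_mul_add_one, signSum_cons, signSum_phi, abs_le]
    have := sign_eq_or (1 - 𝐭 i)
    omega

theorem not_signEquiv_two_factorAt_even_odd {n : ℕ} (hn : 4 ≤ n) (i j : ℕ) :
    ¬ SignEquiv 2 (factorAt 𝐭 (2 * i) n) (factorAt 𝐭 (2 * j + 1) n) := by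
  obtain ⟨m, rfl | rfl⟩ := n.even_or_odd'
  · obtain ⟨m, rfl⟩ : ∃ l, m = l + 1 := ⟨m - 1, by omega⟩
    rw [factorAt_two_mul_two_mul, factorAt_two_mul_add_one_two_mul_add_two]
    apply not_signEquiv_two_phi_cons_phi_concat
    · rw [length_factorAt, length_factorAt]
    · rw [length_factorAt]
      omega
    · exact abs_signSum_factorAt_le_two i (m + 1)
    · rw [← factorAt_add_two]
      exact abs_signSum_factorAt_le_two j (m + 2)
  · rw [factorAt_two_mul_two_mul_add_one, factorAt_two_mul_add_one_two_mul_add_one]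
    apply not_signEquiv_two_phi_concat_cons_phi (length_factorAt_eq ..)
    · rw [length_factorAt]
      omega
    · rw [← factorAt_succ']
      exact abs_signSum_factorAt_le_two i (m + 1)
    · rw [← factorAt_succ]
      exact abs_signSum_factorAt_le_two j (m + 1)

theorem SignEquiv.exists_phi_decomposition (hk : 0 < k) {i j n : ℕ}
    (h : SignEquiv (k + 1) (factorAt 𝐭 i n) (factorAt 𝐭 j n)) :
    ∃ p s i' j' m, 2 * m ≤ n ∧ SignEquiv k (factorAt 𝐭 i' m) (factorAt 𝐭 j' m) ∧
      factorAt 𝐭 i n = p ++ phi (factorAt 𝐭 i' m) ++ s ∧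
      factorAt 𝐭 j n = p ++ phi (factorAt 𝐭 j' m) ++ s := by
  have h_two := h.mono (by omega : 2 ≤ k + 1)
  by_cases hn : n ≤ 3
  · have h_eq := eq_of_signEquiv_two_of_length_le_three (length_factorAt_eq ..)
      (by rwa [length_factorAt]) h_two
    rw [h_eq]
    exact ⟨factorAt 𝐭 j n, [], 0, 0, 0, by omega, .refl k _, by simp [factorAt, phi],
      by simp [factorAt, phi]⟩
  obtain ⟨i, rfl | rfl⟩ := i.even_or_odd' <;> obtain ⟨j, rfl | rfl⟩ := j.even_or_odd'
  · obtain ⟨m, rfl | rfl⟩ := n.even_or_odd'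
    · simp only [factorAt_two_mul_two_mul] at h ⊢
      exact ⟨[], [], i, j, m, le_rfl, signEquiv_phi_iff.1 h, by simp, by simp⟩
    · simp only [factorAt_two_mul_two_mul_add_one] at h ⊢
      obtain ⟨hs, h'⟩ := (signEquiv_phi_concat_iff (length_factorAt_eq ..)).1 h
      exact ⟨[], [𝐭 (i + m)], i, j, m, by omega, h', by simp, by simp [hs]⟩
  · exact absurd h_two (not_signEquiv_two_factorAt_even_odd (by omega) i j)
  · exact absurd h_two.symm (not_signEquiv_two_factorAt_even_odd (by omega) j i)
  · obtain ⟨m, rfl | rfl⟩ := n.even_or_odd'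
    · obtain ⟨m, rfl⟩ : ∃ l, m = l + 1 := ⟨m - 1, by omega⟩
      simp only [factorAt_two_mul_add_one_two_mul_add_two] at h ⊢
      obtain ⟨hp, hs, h'⟩ := (signEquiv_cons_phi_concat_iff hk (length_factorAt_eq ..)).1 h
      exact ⟨[1 - 𝐭 i], [𝐭 (i + 1 + m)], i + 1, j + 1, m, by omega, h', by simp, by simp [hp, hs]⟩
    · simp only [factorAt_two_mul_add_one_two_mul_add_one] at h ⊢
      obtain ⟨hp, h'⟩ := signEquiv_cons_phi_iff.1 h
      exact ⟨[1 - 𝐭 i], [], i + 1, j + 1, m, by omega, h', by simp, by simp [hp]⟩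

theorem signEquiv_iff_binomSetoid (hk : 0 < k) (i j n : ℕ) :
    SignEquiv k (factorAt 𝐭 i n) (factorAt 𝐭 j n) ↔
      binomSetoid k (factorAt 𝐭 i n) (factorAt 𝐭 j n) := by
  refine ⟨fun h => ?_, signEquiv_of_binomSetoid⟩
  induction k, hk using Nat.le_induction generalizing i j n with
  | base => exact binomSetoid_one_of_signSum_eq (length_factorAt_eq ..) (signEquiv_one_iff.1 h)
  | succ k hk ih =>
    obtain ⟨p, s, i', j', m, -, h', hi, hj⟩ := h.exists_phi_decomposition hk
    rw [hi, hj]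
    exact binomSetoid_append_right s <| binomSetoid_append_left p <|
      binomSetoid_phi (ih i' j' m h') (length_factorAt_eq ..)

theorem SignEquiv.factorAt_eq (hk : 0 < k) {i j n : ℕ} (hn : n < 2 ^ k)
    (h : SignEquiv k (factorAt 𝐭 i n) (factorAt 𝐭 j n)) : factorAt 𝐭 i n = factorAt 𝐭 j n := by
  induction k, hk using Nat.le_induction generalizing i j n with
  | base =>
    exact eq_of_signEquiv_one_of_length_le_one (length_factorAt_eq ..)
      (by rw [length_factorAt]; omega) h
  | succ k hk ih =>
    obtain ⟨p, s, i', j', m, hm, h', hi, hj⟩ := h.exists_phi_decomposition hk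
    rw [hi, hj, ih (by omega) h']

theorem exists_thueMorse_pair {d : ℕ} (hd : 0 < d) (a b : Letter) :
    ∃ i, 𝐭 i = a ∧ 𝐭 (i + d) = b := by
  induction d using Nat.strong_induction_on generalizing a b with
  | _ d ih =>
    obtain ⟨e, rfl | rfl⟩ := d.even_or_odd'
    · obtain ⟨i, hi, hid⟩ := ih e (by omega) (by omega) a b
      exact ⟨2 * i, by rw [thueMorse_two_mul, hi], by rw [← mul_add, thueMorse_two_mul, hid]⟩
    · rcases e.eq_zero_or_pos with rfl | he
      · have h_one : ∀ a b : Letter, ∃ i < 6, 𝐭 i = a ∧ 𝐭 (i + 1) = b := by decide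
        obtain ⟨i, -, hi⟩ := h_one a b
        exact ⟨i, hi⟩
      · obtain ⟨i, hi, hid⟩ := ih (e + 1) (by omega) (by omega) (1 - a) b
        refine ⟨2 * i + 1, ?_, ?_⟩
        · rw [thueMorse_two_mul_add_one, hi, sub_sub_cancel]
        · rw [show 2 * i + 1 + (2 * e + 1) = 2 * (i + (e + 1)) by ring, thueMorse_two_mul, hid]

/-! ### Ranges of sequences -/

section Ranges

variable {γ : Type*}

theorem encard_range_congr {ι δ : Type*} {c : ι → γ} {d : ι → δ}
    (h : ∀ i j, c i = c j ↔ d i = d j) : (Set.range c).encard = (Set.range d).encard := by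
  have h_ker : Setoid.ker c = Setoid.ker d := Setoid.ext h
  have e := Setoid.quotientKerEquivRange d
  rw [← h_ker] at e
  exact ENat.card_congr ((Setoid.quotientKerEquivRange c).symm.trans e)

theorem range_eq_union_even_odd (c : ℕ → γ) :
    Set.range c = Set.range (fun i => c (2 * i)) ∪ Set.range (fun i => c (2 * i + 1)) := by
  refine subset_antisymm ?_ (Set.union_subset ?_ ?_)
  · rintro _ ⟨i, rfl⟩
    obtain ⟨i, rfl | rfl⟩ := i.even_or_odd'
    · exact Or.inl ⟨i, rfl⟩
    · exact Or.inr ⟨i, rfl⟩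
  all_goals exact Set.range_comp_subset_range _ c

theorem encard_range_even_odd {c : ℕ → γ} (h : ∀ i j, c (2 * i) ≠ c (2 * j + 1)) :
    (Set.range c).encard =
      (Set.range fun i => c (2 * i)).encard + (Set.range fun i => c (2 * i + 1)).encard := by
  rw [range_eq_union_even_odd, Set.encard_union_eq]
  rw [Set.disjoint_left]
  rintro _ ⟨i, rfl⟩ ⟨j, hj⟩
  exact h i j hj.symm

theorem range_thueMorse_pair [DecidableEq γ] {d : ℕ} (hd : 0 < d) (G : Letter → Letter → γ) :
    Set.range (fun i => G (𝐭 i) (𝐭 (i + d))) =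
      ↑(Finset.univ.image fun p : Letter × Letter => G p.1 p.2) := by
  rw [Finset.coe_image, Finset.coe_univ, Set.image_univ]
  apply subset_antisymm
  · rintro _ ⟨i, rfl⟩
    exact ⟨(𝐭 i, 𝐭 (i + d)), rfl⟩
  · rintro _ ⟨⟨a, b⟩, rfl⟩
    obtain ⟨i, hi, hid⟩ := exists_thueMorse_pair hd a b
    exact ⟨i, congrArg₂ G hi hid⟩

end Ranges

/-! ### Counting classes -/

/-- Sign equivalence of order `k`, refined by the first letter if `f` is set and by the last letter
if `l` is set. The refinements are what desubstitution produces at the two ends of a factor. -/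
def signSetoid (k : ℕ) (f l : Bool) : Setoid Word where
  r u v := SignEquiv k u v ∧ (f → u.head? = v.head?) ∧ (l → u.getLast? = v.getLast?)
  iseqv :=
    { refl := fun u => ⟨.refl k u, fun _ => rfl, fun _ => rfl⟩
      symm := fun h => ⟨h.1.symm, fun hf => (h.2.1 hf).symm, fun hl => (h.2.2 hl).symm⟩
      trans := fun h h' => ⟨h.1.trans h'.1, fun hf => (h.2.1 hf).trans (h'.2.1 hf),
        fun hl => (h.2.2 hl).trans (h'.2.2 hl)⟩ }

theorem signSetoid_iff {f l : Bool} :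
    signSetoid k f l u v ↔
      SignEquiv k u v ∧ (f → u.head? = v.head?) ∧ (l → u.getLast? = v.getLast?) :=
  Iff.rfl

theorem one_sub_injective : Function.Injective fun a : Letter => 1 - a :=
  sub_right_injective

theorem head?_phi (u : Word) : (phi u).head? = u.head? := by
  cases u with
  | nil => rfl
  | cons a u => rw [phi_cons, List.head?_cons, List.head?_cons]

theorem getLast?_phi (u : Word) : (phi u).getLast? = u.getLast?.map (1 - ·) := by
  induction u using List.reverseRecOn with
  | nil => rfl
  | append_singleton u a =>
    rw [phi_append, phi_cons]
    simp [phi]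

theorem signSetoid_phi_iff (f l : Bool) :
    signSetoid (k + 1) f l (phi u) (phi v) ↔ signSetoid k f l u v := by
  simp only [signSetoid_iff, signEquiv_phi_iff, head?_phi, getLast?_phi,
    (Option.map_injective one_sub_injective).eq_iff]

theorem signSetoid_phi_concat_iff (f l : Bool) {b b' : Letter} (hl : u.length = v.length) :
    signSetoid (k + 1) f l (phi u ++ [b]) (phi v ++ [b']) ↔
      signSetoid k f true (u ++ [b]) (v ++ [b']) := by
  simp only [signSetoid_iff, signEquiv_phi_concat_iff hl, List.getLast?_concat, List.head?_append,
    head?_phi, Option.some_inj, true_imp_iff]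
  constructor
  · rintro ⟨⟨rfl, h⟩, h_head, -⟩
    exact ⟨(signEquiv_concat_iff b hl).2 h, h_head, rfl⟩
  · rintro ⟨h, h_head, rfl⟩
    exact ⟨⟨rfl, (signEquiv_concat_iff b hl).1 h⟩, h_head, fun _ => rfl⟩

theorem signSetoid_cons_phi_iff (f l : Bool) {a a' : Letter} :
    signSetoid (k + 1) f l ((1 - a) :: phi u) ((1 - a') :: phi v) ↔
      signSetoid k true l (a :: u) (a' :: v) := by
  have h_last (a : Letter) (u : Word) :
      ((1 - a) :: phi u).getLast? = (a :: u).getLast?.map (1 - ·) := by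
    simp [List.getLast?_cons, getLast?_phi, Option.getD_map]
  simp only [signSetoid_iff, signEquiv_cons_phi_iff, h_last, one_sub_injective.eq_iff,
    (Option.map_injective one_sub_injective).eq_iff, List.head?_cons, Option.some_inj,
    true_imp_iff]
  constructor
  · rintro ⟨⟨rfl, h⟩, -, h_last⟩
    exact ⟨(signEquiv_cons_iff a).2 h, rfl, h_last⟩
  · rintro ⟨h, rfl, h_last⟩
    exact ⟨⟨rfl, (signEquiv_cons_iff a).1 h⟩, fun _ => rfl, h_last⟩

theorem signSetoid_cons_phi_concat_iff (hk : 0 < k) (f l : Bool) {a a' b b' : Letter}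
    (hl : u.length = v.length) :
    signSetoid (k + 1) f l ((1 - a) :: (phi u ++ [b])) ((1 - a') :: (phi v ++ [b'])) ↔
      signSetoid k true true (a :: (u ++ [b])) (a' :: (v ++ [b'])) := by
  have h_last (a : Letter) (u : Word) (b : Letter) : (a :: (u ++ [b])).getLast? = some b := by
    rw [← List.cons_append, List.getLast?_concat]
  simp only [signSetoid_iff, signEquiv_cons_phi_concat_iff hk hl, h_last, List.head?_cons,
    Option.some_inj, one_sub_injective.eq_iff, true_imp_iff]
  constructor
  · rintro ⟨⟨rfl, rfl, h⟩, -, -⟩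
    exact ⟨(signEquiv_cons_iff a).2 ((signEquiv_concat_iff b hl).2 h), rfl, rfl⟩
  · rintro ⟨h, rfl, rfl⟩
    exact ⟨⟨rfl, rfl, (signEquiv_concat_iff b hl).1 ((signEquiv_cons_iff a).1 h)⟩, fun _ => rfl,
      fun _ => rfl⟩

/-- The number of classes of factors of length `n` of `𝐭` under `signSetoid k f l`. -/
noncomputable def numClasses (k : ℕ) (f l : Bool) (n : ℕ) : ℕ∞ :=
  (Set.range fun i => (⟦factorAt 𝐭 i n⟧ : Quotient (signSetoid k f l))).encard

theorem numClasses_congr {γ : Type*} {f l : Bool} {n : ℕ} {c : ℕ → γ}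
    (h : ∀ i j, signSetoid k f l (factorAt 𝐭 i n) (factorAt 𝐭 j n) ↔ c i = c j) :
    numClasses k f l n = (Set.range c).encard :=
  encard_range_congr fun i j => Quotient.eq.trans (h i j)

theorem numClasses_eq_add {f l : Bool} {n : ℕ} (hk : 2 ≤ k) (hn : 4 ≤ n) :
    numClasses k f l n =
      (Set.range fun i => (⟦factorAt 𝐭 (2 * i) n⟧ : Quotient (signSetoid k f l))).encard +
      (Set.range fun i => (⟦factorAt 𝐭 (2 * i + 1) n⟧ : Quotient (signSetoid k f l))).encard :=
  encard_range_even_odd fun i j h =>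
    not_signEquiv_two_factorAt_even_odd hn i j ((Quotient.exact h).1.mono hk)

theorem numClasses_succ_two_mul {m : ℕ} (f l : Bool) (hk : 0 < k) (hm : 0 < m) :
    numClasses (k + 1) f l (2 * (m + 1)) =
      numClasses k f l (m + 1) + numClasses k true true (m + 2) := by
  rw [numClasses_eq_add (by omega) (by omega)]
  congr 1 <;> refine encard_range_congr fun i j => Quotient.eq.trans (.trans ?_ Quotient.eq.symm)
  · rw [factorAt_two_mul_two_mul, factorAt_two_mul_two_mul]
    exact signSetoid_phi_iff f l
  · simp only [factorAt_two_mul_add_one_two_mul_add_two, factorAt_add_two]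
    exact signSetoid_cons_phi_concat_iff hk f l (length_factorAt_eq ..)

theorem numClasses_succ_two_mul_add_one {m : ℕ} (f l : Bool) (hk : 0 < k) (hm : 2 ≤ m) :
    numClasses (k + 1) f l (2 * m + 1) =
      numClasses k f true (m + 1) + numClasses k true l (m + 1) := by
  rw [numClasses_eq_add (by omega) (by omega)]
  congr 1 <;> refine encard_range_congr fun i j => Quotient.eq.trans (.trans ?_ Quotient.eq.symm)
  · rw [factorAt_two_mul_two_mul_add_one, factorAt_two_mul_two_mul_add_one, factorAt_succ' 𝐭 i m,
      factorAt_succ' 𝐭 j m]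
    exact signSetoid_phi_concat_iff f l (length_factorAt_eq ..)
  · rw [factorAt_two_mul_add_one_two_mul_add_one, factorAt_two_mul_add_one_two_mul_add_one,
      factorAt_succ 𝐭 i m, factorAt_succ 𝐭 j m]
    exact signSetoid_cons_phi_iff f l

/-- The data that determines a class of `signSetoid 1 f l`, for a word with first letter `a`, last
letter `b` and sum of signs `s`. -/
def profile (f l : Bool) (a b : Letter) (s : ℤ) : Option Letter × Option Letter × ℤ :=
  (if f then some a else none, if l then some b else none, s)

theorem numClasses_one_eq_encard (f l : Bool) (n : ℕ) :
    numClasses 1 f l (n + 1) =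
      (Set.range fun i =>
        profile f l (𝐭 i) (𝐭 (i + n)) (signSum (factorAt 𝐭 i (n + 1)))).encard := by
  refine numClasses_congr fun i j => ?_
  rw [signSetoid_iff, signEquiv_one_iff, head?_factorAt_succ, head?_factorAt_succ,
    getLast?_factorAt_succ, getLast?_factorAt_succ]
  cases f <;> cases l <;> simp [profile, and_comm, and_left_comm]

theorem numClasses_one_two {f l : Bool} (h : f = true → l = false) :
    numClasses 1 f l 2 =
      (2 + 2 * f.toNat + 2 * l.toNat + if f = false ∧ l = false then 1 else 0 : ℕ) := by
  have h_range := range_thueMorse_pair one_pos fun a b => profile f l a b (signSum [a, b])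
  rw [(numClasses_one_eq_encard f l 1).trans (congrArg Set.encard h_range),
    Set.encard_coe_eq_coe_finsetCard, Nat.cast_inj]
  clear h_range
  decide +revert

theorem numClasses_one_two_mul_add_one {m : ℕ} (f l : Bool) (hm : 0 < m) :
    numClasses 1 f l (2 * m + 1) = (2 + 2 * f.toNat + 2 * l.toNat : ℕ) := by
  rw [numClasses_one_eq_encard, range_eq_union_even_odd]
  have h_even (i : ℕ) : 2 * i + 2 * m = 2 * (i + m) := by ring
  have h_odd (i : ℕ) : 2 * i + 1 + 2 * m = 2 * (i + m) + 1 := by ring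
  simp only [h_even, h_odd, thueMorse_two_mul, thueMorse_two_mul_add_one,
    factorAt_two_mul_two_mul_add_one, factorAt_two_mul_add_one_two_mul_add_one, signSum_concat,
    signSum_cons, signSum_phi]
  rw [range_thueMorse_pair hm fun a b => profile f l a b (0 + sign b),
    range_thueMorse_pair hm fun a b => profile f l (1 - a) (1 - b) (sign (1 - a) + 0),
    ← Finset.coe_union, Set.encard_coe_eq_coe_finsetCard, Nat.cast_inj]
  clear * -
  decide +revert

theorem numClasses_one_two_mul_add_two {m : ℕ} (f l : Bool) (hm : 0 < m) :
    numClasses 1 f l (2 * (m + 1)) =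
      (2 + 2 * f.toNat + 2 * l.toNat + if f = false ∧ l = false then 1 else 0 : ℕ) := by
  refine (numClasses_one_eq_encard f l (2 * m + 1)).trans ?_
  rw [range_eq_union_even_odd]
  have h_even (i : ℕ) : 2 * i + (2 * m + 1) = 2 * (i + m) + 1 := by ring
  have h_odd (i : ℕ) : 2 * i + 1 + (2 * m + 1) = 2 * (i + (m + 1)) := by ring
  have h_last (i : ℕ) : i + 1 + m = i + (m + 1) := by ring
  simp only [h_even, h_odd, ← mul_add_one 2 m, thueMorse_two_mul, thueMorse_two_mul_add_one,
    factorAt_two_mul_two_mul, factorAt_two_mul_add_one_two_mul_add_two, signSum_phi,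
    signSum_cons_phi_concat, h_last]
  rw [range_thueMorse_pair hm fun a b => profile f l a (1 - b) 0,
    range_thueMorse_pair m.succ_pos fun a b => profile f l (1 - a) b (sign (1 - a) + sign b),
    ← Finset.coe_union, Set.encard_coe_eq_coe_finsetCard, Nat.cast_inj]
  clear * -
  decide +revert

theorem numClasses_one {f l : Bool} {n : ℕ} (hn : 2 ≤ n) (h : f = true → l = true → 2 < n) :
    numClasses 1 f l n =
      (2 + 2 * f.toNat + 2 * l.toNat + if f = false ∧ l = false ∧ 2 ∣ n then 1 else 0 : ℕ) := by
  obtain ⟨m, rfl | rfl⟩ := n.even_or_odd'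
  · rcases (by omega : m = 1 ∨ 1 < m) with rfl | hm
    · simpa using numClasses_one_two (f := f) (l := l) (by simpa using h)
    · obtain ⟨m, rfl⟩ : ∃ d, m = d + 1 := ⟨m - 1, by omega⟩
      simpa using numClasses_one_two_mul_add_two f l (by omega)
  · rw [numClasses_one_two_mul_add_one f l (by omega), if_neg (by omega), add_zero]

theorem numClasses_eq (hk : 0 < k) {f l : Bool} {n : ℕ} (hn : 2 ^ k ≤ n)
    (h : f = true → l = true → 2 ^ k < n) :
    numClasses k f l n = (3 * 2 ^ k - 4 + 2 * f.toNat + 2 * l.toNat +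
      if f = false ∧ l = false ∧ 2 ^ k ∣ n then 1 else 0 : ℕ) := by
  induction k, hk using Nat.le_induction generalizing f l n with
  | base => exact numClasses_one hn h
  | succ k hk ih =>
    have h_pow : 2 ≤ 2 ^ k := Nat.le_self_pow (by omega) 2
    rw [pow_succ'] at hn h ⊢
    obtain ⟨m, rfl | rfl⟩ := n.even_or_odd'
    · obtain ⟨m, rfl⟩ : ∃ d, m = d + 1 := ⟨m - 1, by omega⟩
      rw [numClasses_succ_two_mul f l hk (by omega),
        ih (by omega) fun hf hl => by have := h hf hl; omega,
        ih (by omega) fun _ _ => by omega, ← Nat.cast_add, Nat.cast_inj]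
      simp only [Nat.mul_dvd_mul_iff_left two_pos, Bool.toNat_true, Bool.true_eq_false, false_and,
        if_false]
      omega
    · have h_not_dvd : ¬ 2 * 2 ^ k ∣ 2 * m + 1 := fun h => by
        have := (Dvd.intro _ rfl).trans h
        omega
      rw [numClasses_succ_two_mul_add_one f l hk (by omega),
        ih (by omega) fun _ _ => by omega, ih (by omega) fun _ _ => by omega, ← Nat.cast_add,
        Nat.cast_inj]
      simp only [Bool.toNat_true, Bool.true_eq_false, h_not_dvd, false_and, and_false, if_false]
      omega

/-! ### Complexities -/

theorem binomComplexity_eq_numClasses (hk : 0 < k) (n : ℕ) :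
    binomComplexity 𝐭 k n = (numClasses k false false n).toNat := by
  let s := (binomSetoid k).comap (Subtype.val : Fac 𝐭 n → Word)
  let c (i : ℕ) : Quotient s := ⟦⟨factorAt 𝐭 i n, i, rfl⟩⟧
  have hc : Function.Surjective c := by
    rintro ⟨_, i, rfl⟩
    exact ⟨i, rfl⟩
  rw [numClasses_congr (c := c), hc.range_eq, Set.encard_univ]
  · rfl
  · intro i j
    simp only [signSetoid_iff, signEquiv_iff_binomSetoid hk, Bool.false_eq_true, false_imp_iff,
      and_true]
    exact ⟨fun h => Quotient.sound (s := s) h, fun h => Quotient.exact (s := s) h⟩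

theorem binomComplexity_eq_factorComplexity (hk : 0 < k) {n : ℕ} (hn : n < 2 ^ k) :
    binomComplexity 𝐭 k n = factorComplexity 𝐭 n := by
  refine (Nat.card_congr (Equiv.ofBijective (Quotient.mk _) ⟨?_, Quotient.mk_surjective⟩)).symm
  rintro ⟨_, i, rfl⟩ ⟨_, j, rfl⟩ h
  have h_binom : binomSetoid k (factorAt 𝐭 i n) (factorAt 𝐭 j n) := (Quotient.exact h :)
  exact Subtype.ext ((signEquiv_of_binomSetoid h_binom).factorAt_eq hk hn)

theorem binomComplexity_eq (hk : 0 < k) {n : ℕ} (hn : 2 ^ k ≤ n) :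
    binomComplexity 𝐭 k n = 3 * 2 ^ k - 4 + if 2 ^ k ∣ n then 1 else 0 := by
  rw [binomComplexity_eq_numClasses hk, numClasses_eq hk hn (by simp), ENat.toNat_natCast]
  simp

end ThueMorse

theorem theorem1 (k : ℕ) (hk : 0 < k) :
    (∀ n : ℕ, n ≤ 2 ^ k - 1 →
      ThueMorse.binomComplexity ThueMorse.thueMorse k n =
        ThueMorse.factorComplexity ThueMorse.thueMorse n) ∧
    (∀ n : ℕ, 2 ^ k ≤ n →
      ThueMorse.binomComplexity ThueMorse.thueMorse k n =
        if n ≡ 0 [MOD 2 ^ k] then 3 * 2 ^ k - 3 else 3 * 2 ^ k - 4) := by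
  have h_pow : 2 ≤ 2 ^ k := Nat.le_self_pow hk.ne' 2
  refine ⟨fun n hn => ?_, fun n hn => ?_⟩
  · exact ThueMorse.binomComplexity_eq_factorComplexity hk (by omega)
  · rw [ThueMorse.binomComplexity_eq hk hn]
    simp only [Nat.modEq_zero_iff_dvd]
    split_ifs <;> omega
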